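/- Let $m > n \geq 2$ be integers, and let $\mathcal{S}_{m,n}$ be the set of complex symmetric $m\times m$ matrices $A$ of rank at most $n$ with constant diagonal, $A_{11} = A_{22} = \dots = A_{mm}$, with the Zariski topology induced from the affine space $\mathbb{C}^{m\times m}$. For symmetric $m \times m$ matrices $A$ and $B$, call $B$ a symmetric rearrangement of $A$ if $A$ and $B$ have the same diagonal and the set of triples $\{(A_{ii},A_{jj},A_{ij}) : i\neq j\}$ equals the set of triples $\{(B_{ii},B_{jj},B_{ij}) : i \neq j\}$. Call $B$ equivalent to $A$ if there is a permutation $\sigma$ of $\{1,\dots,m\}$ such that $B_{ij} = A_{\sigma(i)\sigma(j)}$ for all $i,j$; if $A = X^\top X$, this means that $B = Y^\top Y$ where $Y$ is obtained by permuting the columns of $X$. Then there is a non-empty Zariski open subset $U$ of $\mathcal{S}_{m,n}$ such that, for every $A \in U$ and every symmetric rearrangement $B$ of $A$ that is not equivalent to $A$, $\operatorname{rank}(B) > n$. -/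

import Mathlib

/-- The space of complex symmetric `m × m` matrices of rank at most `n` with constant diagonal. -/
def SymConstDiag (m n : ℕ) : Set (Matrix (Fin m) (Fin m) ℂ) :=
  {A | A.IsSymm ∧ A.rank ≤ n ∧ ∀ i j, A i i = A j j}

/-- `U` is an open subset of `S` for the topology induced on `S` by the Zariski topology of the
affine space of complex `m × m` matrices. -/
def IsZariskiOpenIn {m : ℕ} (U S : Set (Matrix (Fin m) (Fin m) ℂ)) : Prop :=
  ∃ I : Ideal (MvPolynomial (Fin m × Fin m) ℂ),
    U = {A | A ∈ S ∧ (fun p : Fin m × Fin m => A p.1 p.2) ∉ MvPolynomial.zeroLocus ℂ I}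

/-- The set of triples `(A i i, A j j, A i j)`, over all pairs of distinct indices. -/
def tripleSet {m : ℕ} (A : Matrix (Fin m) (Fin m) ℂ) : Set (ℂ × ℂ × ℂ) :=
  {t | ∃ i j, i ≠ j ∧ t = (A i i, A j j, A i j)}

/-- `B` is a symmetric rearrangement of `A`. -/
def IsSymmRearrangement {m : ℕ} (A B : Matrix (Fin m) (Fin m) ℂ) : Prop :=
  A.IsSymm ∧ B.IsSymm ∧ (∀ i, B i i = A i i) ∧ tripleSet B = tripleSet A

/-- `B` is equivalent to `A`: it is obtained by applying one permutation to the rows and the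
columns of `A`. If `A = Xᵀ * X`, this says that `B = Yᵀ * Y`, where `Y` is obtained by permuting
the columns of `X`; see `matrixEquivalent_gram_iff`. -/
def MatrixEquivalent {m : ℕ} (A B : Matrix (Fin m) (Fin m) ℂ) : Prop :=
  ∃ σ : Equiv.Perm (Fin m), B = A.submatrix σ σ

open scoped Matrix in
/-- For a Gram matrix, equivalence means permuting the columns of the Gram factor,
whichever factor is chosen. -/
theorem matrixEquivalent_gram_iff {m k : ℕ} (X : Matrix (Fin k) (Fin m) ℂ)
    (B : Matrix (Fin m) (Fin m) ℂ) :
    MatrixEquivalent (Xᵀ * X) B ↔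
      ∃ σ : Equiv.Perm (Fin m), B = (X.submatrix id σ)ᵀ * X.submatrix id σ :=
  Iff.rfl

/-! Vectors of equal norm in `n`-space have a polynomial parametrization (`sphereParam`), and their
Gram matrices lie in the given variety. Nonzero polynomials have a nonzero product, so finitely many
polynomial conditions, each satisfied at its own test family of unit vectors, hold together at one
point. The open set is the non-vanishing locus of the product of all of them.

One group of conditions makes the entries above the diagonal distinct; a symmetric rearrangement is
then a permutation `π` of the unordered pairs of indices. It remains to find, for each `π` not
induced by a permutation of the points, a test family for which some principal `(n + 1)`-minor of
the rearranged matrix is nonzero.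

Suppose that there is none. If the image under `π` of the edges of an `(n + 1)`-set `K` is
`n`-colourable, placing a basis vector on each colour turns the minor on `K` into that of the
identity. A graph with `(n + 1).choose 2` edges is `n`-colourable unless its edges form a clique, so
`π` maps `(n + 1)`-cliques to cliques. For `n = 2` these are triangles. For `n ≥ 3`, vectors
orthonormal up to one planar triple show that `π.symm` maps triangles to triangles. A permutation of
pairs with that property comes from the points, a contradiction. -/

/-! ### Colouring graphs with few edges -/

open Finset in
/-- A graph with at most `n (n + 1) / 2` edges inside `s` can be properly coloured on `s` with `n`
colours, unless it has a clique on `n + 1` vertices of `s`. -/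
theorem SimpleGraph.exists_coloring_or_isNClique {V : Type*} [DecidableEq V] (G : SimpleGraph V)
    [DecidableRel G.Adj] {n : ℕ} (hn : 0 < n) (s : Finset V)
    (hs : ∑ v ∈ s, #{w ∈ s | G.Adj v w} ≤ n * (n + 1)) :
    (∃ c : V → Fin n, ∀ v ∈ s, ∀ w ∈ s, G.Adj v w → c v ≠ c w) ∨
      ∃ L ⊆ s, G.IsNClique (n + 1) L := by
  induction hk : #s generalizing s with
  | zero =>
    left
    rw [Finset.card_eq_zero] at hk
    exact ⟨fun _ => ⟨0, hn⟩, by simp [hk]⟩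
  | succ k ih =>
    by_cases hdeg : ∃ v ∈ s, #{w ∈ s | G.Adj v w} < n
    -- Greedy colouring: a vertex with fewer than `n` neighbours is coloured last.
    · obtain ⟨v, hv, hlt⟩ := hdeg
      have hs' : ∑ x ∈ s.erase v, #{w ∈ s.erase v | G.Adj x w} ≤ n * (n + 1) := by
        refine le_trans ?_ hs
        refine (sum_le_sum fun x _ => card_le_card ?_).trans
          (sum_le_sum_of_subset (erase_subset v s))
        exact filter_subset_filter _ (erase_subset _ _)
      rcases ih (s.erase v) hs' (by rw [card_erase_of_mem hv, hk]; rfl) with ⟨c, hc⟩ | ⟨L, hL, hcl⟩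
      · left
        obtain ⟨a, ha⟩ : ∃ a : Fin n, a ∉ ({w ∈ s | G.Adj v w} : Finset V).image c := by
          by_contra! h
          have : (Finset.univ : Finset (Fin n)) ⊆ ({w ∈ s | G.Adj v w} : Finset V).image c :=
            fun a _ => h a
          have h' := (card_le_card this).trans card_image_le
          rw [card_univ, Fintype.card_fin] at h'
          exact absurd h' (not_le.2 hlt)
        have ha' : ∀ w ∈ s, G.Adj v w → c w ≠ a := fun w hw hvw h =>
          ha (mem_image.2 ⟨w, by simp [hw, hvw], h⟩)
        refine ⟨Function.update c v a, fun x hx y hy hxy => ?_⟩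
        by_cases hxv : x = v
        · subst hxv
          rw [Function.update_self, Function.update_of_ne hxy.ne']
          exact (ha' y hy hxy).symm
        · by_cases hyv : y = v
          · subst hyv
            rw [Function.update_self, Function.update_of_ne hxv]
            exact ha' x hx hxy.symm
          · rw [Function.update_of_ne hxv, Function.update_of_ne hyv]
            exact hc x (mem_erase.2 ⟨hxv, hx⟩) y (mem_erase.2 ⟨hyv, hy⟩) hxy
      · exact Or.inr ⟨L, hL.trans (erase_subset _ _), hcl⟩
    -- If all degrees are at least `n`, the edge bound forces `#s ≤ n + 1`. Either there are enough
    -- colours for all vertices, or `s` has `n + 1` vertices, each adjacent to all the others.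
    · push Not at hdeg
      have hle : #s * n ≤ n * (n + 1) := by
        refine le_trans ?_ hs
        simpa using card_nsmul_le_sum s _ n hdeg
      have hle' : #s ≤ n + 1 := by
        rw [mul_comm] at hle
        exact Nat.le_of_mul_le_mul_left hle hn
      rcases hle'.lt_or_eq with hlt | heq
      · left
        obtain ⟨f, hf⟩ : ∃ f : s → Fin n, Function.Injective f := by
          have : Nonempty (s ↪ Fin n) :=
            Function.Embedding.nonempty_of_card_le (by simpa using Nat.lt_succ_iff.1 hlt)
          exact ⟨this.some, this.some.injective⟩
        refine ⟨fun v => if h : v ∈ s then f ⟨v, h⟩ else ⟨0, hn⟩, fun v hv w hw hvw h => ?_⟩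
        simp only [hv, hw, dite_true] at h
        exact hvw.ne (Subtype.ext_iff.1 (hf h))
      · right
        refine ⟨s, Subset.rfl, ⟨?_, heq⟩⟩
        intro v hv w hw hvw
        have hsub : ({w ∈ s | G.Adj v w} : Finset V) ⊆ s.erase v := by
          intro x hx
          rw [mem_filter] at hx
          exact mem_erase.2 ⟨hx.2.ne', hx.1⟩
        have := eq_of_subset_of_card_le hsub (by
          rw [card_erase_of_mem hv, heq]; exact hdeg v hv)
        have hw' : w ∈ ({w ∈ s | G.Adj v w} : Finset V) := by
          rw [this]; exact mem_erase.2 ⟨hvw.symm, hw⟩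
        exact (mem_filter.1 hw').2

/-- The pairs of distinct elements of a finite set. -/
def Finset.edges {V : Type*} [DecidableEq V] (s : Finset V) : Finset (Sym2 V) :=
  s.sym2.filter fun e => ¬ e.IsDiag

theorem Finset.mk_mem_edges {V : Type*} [DecidableEq V] {s : Finset V} {a b : V} :
    s(a, b) ∈ s.edges ↔ a ∈ s ∧ b ∈ s ∧ a ≠ b := by
  simp [Finset.edges, and_assoc]

theorem Finset.card_edges {V : Type*} [DecidableEq V] (s : Finset V) :
    s.edges.card = s.card.choose 2 := by
  rw [← Sym2.card_image_offDiag]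
  congr 1
  ext e
  induction e with
  | _ a b =>
    rw [Finset.mk_mem_edges]
    simp only [Finset.mem_image, Finset.mem_offDiag, Prod.exists]
    constructor
    · rintro ⟨ha, hb, hab⟩
      exact ⟨a, b, ⟨ha, hb, hab⟩, rfl⟩
    · rintro ⟨x, y, ⟨hx, hy, hxy⟩, h⟩
      have h : s(x, y) = s(a, b) := h
      rw [Sym2.eq_iff] at h
      rcases h with ⟨rfl, rfl⟩ | ⟨rfl, rfl⟩
      · exact ⟨hx, hy, hxy⟩
      · exact ⟨hy, hx, hxy.symm⟩

open Finset in
/-- A set of `n (n + 1) / 2` pairs is the set of edges of a clique or is `n`-colourable. -/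
theorem exists_coloring_or_eq_edges {V : Type*} [Fintype V] [DecidableEq V] {n : ℕ} (hn : 0 < n)
    (F : Finset (Sym2 V)) (hF : ∀ e ∈ F, ¬ e.IsDiag) (hcard : #F = (n + 1).choose 2) :
    (∃ c : V → Fin n, ∀ v w, s(v, w) ∈ F → c v ≠ c w) ∨
      ∃ L : Finset V, #L = n + 1 ∧ F = L.edges := by
  classical
  set G : SimpleGraph V := SimpleGraph.fromEdgeSet (F : Set (Sym2 V)) with hG
  have hadj : ∀ v w, G.Adj v w ↔ s(v, w) ∈ F := by
    intro v w
    rw [hG, SimpleGraph.fromEdgeSet_adj]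
    constructor
    · exact fun h => h.1
    · exact fun h => ⟨h, fun hvw => hF _ h (by simpa using hvw)⟩
  have hedge : G.edgeFinset = F := by
    ext e
    induction e with
    | _ a b => rw [SimpleGraph.mem_edgeFinset, SimpleGraph.mem_edgeSet, hadj]
  have hsum : ∑ v ∈ univ, #{w ∈ univ | G.Adj v w} ≤ n * (n + 1) := by
    have h := G.sum_degrees_eq_twice_card_edges
    simp only [← SimpleGraph.card_neighborFinset_eq_degree, SimpleGraph.neighborFinset_eq_filter]
      at h
    have h' : ∑ v ∈ univ, #{w ∈ univ | G.Adj v w} = 2 * #F := by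
      rw [h]
      congr 2
      convert hedge
    rw [h', hcard, Nat.choose_two_right, Nat.mul_div_cancel']
    · simp [mul_comm]
    · exact (Nat.even_mul_pred_self (n + 1)).two_dvd
  rcases G.exists_coloring_or_isNClique hn univ hsum with ⟨c, hc⟩ | ⟨L, -, hL⟩
  · exact Or.inl ⟨c, fun v w h => hc v (mem_univ _) w (mem_univ _) ((hadj v w).2 h)⟩
  · refine Or.inr ⟨L, hL.card_eq, (eq_of_subset_of_card_le ?_ ?_).symm⟩
    · intro e he
      induction e with
      | _ a b =>
        rw [mk_mem_edges] at he
        exact (hadj a b).1 (hL.isClique he.1 he.2.1 he.2.2)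
    · rw [hcard, card_edges, hL.card_eq]

/-! ### Permutations of pairs and triangles -/

/-- A permutation of the unordered pairs which maps triangles to triangles is induced by a
permutation of the points. -/
theorem exists_perm_of_triangles {V : Type*} [Finite V] (hV : 3 ≤ Nat.card V)
    (π : Equiv.Perm (Sym2 V)) (hπ : ∀ e, ¬ e.IsDiag → ¬ (π e).IsDiag)
    (htri : ∀ x y z, x ≠ y → x ≠ z → y ≠ z →
      ∃ p q r, π s(x, y) = s(p, q) ∧ π s(x, z) = s(p, r) ∧ π s(y, z) = s(q, r)) :
    ∃ σ : Equiv.Perm V, ∀ x y, x ≠ y → π s(x, y) = s(σ x, σ y) := by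
  classical
  have : Fintype V := Fintype.ofFinite V
  have hthird : ∀ a b : V, ∃ c, c ≠ a ∧ c ≠ b := by
    intro a b
    by_contra! h
    have hsub : (Finset.univ : Finset V) ⊆ {a, b} := by
      intro c _
      by_cases hc : c = a
      · simp [hc]
      · simp [h c hc]
    have := (Finset.card_le_card hsub).trans Finset.card_le_two
    rw [Finset.card_univ, ← Nat.card_eq_fintype_card] at this
    omega
  have htri' : ∀ x y z, x ≠ y → x ≠ z → y ≠ z → ∃ p q r, p ≠ q ∧ p ≠ r ∧ q ≠ r ∧
      π s(x, y) = s(p, q) ∧ π s(x, z) = s(p, r) ∧ π s(y, z) = s(q, r) := by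
    intro x y z hxy hxz hyz
    obtain ⟨p, q, r, h1, h2, h3⟩ := htri x y z hxy hxz hyz
    refine ⟨p, q, r, ?_, ?_, ?_, h1, h2, h3⟩
    · simpa [h1] using hπ s(x, y) (by simpa using hxy)
    · simpa [h2] using hπ s(x, z) (by simpa using hxz)
    · simpa [h3] using hπ s(y, z) (by simpa using hyz)
  -- Stars go to stars. The images of `va` and `vb` meet in `p`, and the image of `vw` meets both.
  -- If it missed `p`, it would be the third side `qr`, already the image of `ab`.
  have hcenter : ∀ v, ∃ p, ∀ w, v ≠ w → p ∈ π s(v, w) := by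
    intro v
    obtain ⟨a, hav, -⟩ := hthird v v
    obtain ⟨b, hbv, hba⟩ := hthird v a
    obtain ⟨p, q, r, hpq, hpr, hqr, h1, h2, h3⟩ := htri' v a b hav.symm hbv.symm hba.symm
    refine ⟨p, fun w hvw => ?_⟩
    by_cases hwa : w = a
    · rw [hwa, h1]; exact Sym2.mem_mk_left _ _
    by_cases hwb : w = b
    · rw [hwb, h2]; exact Sym2.mem_mk_left _ _
    by_contra hp
    obtain ⟨p₁, q₁, r₁, -, -, -, h4, h5, -⟩ := htri' v a w hav.symm hvw (Ne.symm hwa)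
    obtain ⟨p₂, q₂, r₂, -, -, -, h6, h7, -⟩ := htri' v b w hbv.symm hvw (Ne.symm hwb)
    have m1 : p₁ ∈ s(p, q) := by rw [← h1, h4]; exact Sym2.mem_mk_left _ _
    have m2 : p₂ ∈ s(p, r) := by rw [← h2, h6]; exact Sym2.mem_mk_left _ _
    have m3 : p₁ ∈ π s(v, w) := by rw [h5]; exact Sym2.mem_mk_left _ _
    have m4 : p₂ ∈ π s(v, w) := by rw [h7]; exact Sym2.mem_mk_left _ _
    rw [Sym2.mem_iff] at m1 m2
    have e1 : p₁ = q := m1.resolve_left fun h => hp (h ▸ m3)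
    have e2 : p₂ = r := m2.resolve_left fun h => hp (h ▸ m4)
    rw [e1] at m3
    rw [e2] at m4
    have h8 : π s(v, w) = π s(a, b) := by
      rw [h3]; exact (Sym2.mem_and_mem_iff hqr).1 ⟨m3, m4⟩
    have h9 := π.injective h8
    rw [Sym2.eq_iff] at h9
    rcases h9 with ⟨h, -⟩ | ⟨h, -⟩
    · exact hav h.symm
    · exact hbv h.symm
  choose σ hσ using hcenter
  have hinj : Function.Injective σ := by
    intro v w hvw
    by_contra hne
    obtain ⟨x, hxv, hxw⟩ := hthird v w
    obtain ⟨p, q, r, hpq, hpr, hqr, h1, h2, h3⟩ := htri' v w x hne hxv.symm hxw.symm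
    have m1 := hσ v w hne
    have m2 := hσ v x hxv.symm
    have m3 := hσ w x hxw.symm
    rw [h1, Sym2.mem_iff] at m1
    rw [h2, Sym2.mem_iff] at m2
    rw [← hvw, h3, Sym2.mem_iff] at m3
    grind
  refine ⟨Equiv.ofBijective σ (Finite.injective_iff_bijective.1 hinj), fun x y hxy => ?_⟩
  refine (Sym2.mem_and_mem_iff (hinj.ne hxy)).1 ⟨hσ x y hxy, ?_⟩
  rw [Sym2.eq_swap]
  exact hσ y x hxy.symm

/-- Three pairwise intersecting pairs form a triangle or a star. -/
theorem Sym2.triangle_or_star {V : Type*} {e f g : Sym2 V} (he : ¬ e.IsDiag) (hf : ¬ f.IsDiag)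
    (hg : ¬ g.IsDiag) (hef : e ≠ f) (heg : e ≠ g) (hfg : f ≠ g) (h₁ : ∃ p, p ∈ e ∧ p ∈ f)
    (h₂ : ∃ p, p ∈ e ∧ p ∈ g) (h₃ : ∃ p, p ∈ f ∧ p ∈ g) :
    (∃ p q r, e = s(p, q) ∧ f = s(p, r) ∧ g = s(q, r)) ∨
      ∃ p a b c, e = s(p, a) ∧ f = s(p, b) ∧ g = s(p, c) := by
  obtain ⟨p, hpe, hpf⟩ := h₁
  obtain ⟨a, rfl⟩ := hpe
  obtain ⟨b, rfl⟩ := hpf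
  by_cases hp : p ∈ g
  · obtain ⟨c, rfl⟩ := hp
    exact Or.inr ⟨p, a, b, c, rfl, rfl, rfl⟩
  · left
    obtain ⟨x, hx, hxg⟩ := h₂
    obtain ⟨y, hy, hyg⟩ := h₃
    rw [Sym2.mem_iff] at hx hy
    have hxa : x = a := hx.resolve_left fun h => hp (h ▸ hxg)
    have hyb : y = b := hy.resolve_left fun h => hp (h ▸ hyg)
    subst hxa hyb
    refine ⟨p, x, y, rfl, rfl, (Sym2.mem_and_mem_iff ?_).1 ⟨hxg, hyg⟩⟩
    rintro rfl
    exact hef rfl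

/-! ### Rearranged Gram matrices and test families -/

/-- The entry of a symmetric matrix at an unordered pair of indices. -/
noncomputable def Matrix.symEntry {V R : Type*} (M : Matrix V V R) (e : Sym2 V) : R :=
  M e.out.1 e.out.2

theorem Matrix.symEntry_mk {V R : Type*} {M : Matrix V V R} (hM : M.IsSymm) (i j : V) :
    M.symEntry s(i, j) = M i j := by
  have h : s(s(i, j).out.1, s(i, j).out.2) = s(i, j) := Quot.out_eq _
  rw [Sym2.eq_iff] at h
  rcases h with ⟨h1, h2⟩ | ⟨h1, h2⟩
  · rw [Matrix.symEntry, h1, h2]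
  · rw [Matrix.symEntry, h1, h2, hM.apply]

/-- The matrix whose entries are those of `M`, moved by a map of the unordered pairs of indices. -/
noncomputable def Matrix.rearrange {V R : Type*} (π : Sym2 V → Sym2 V) (M : Matrix V V R) :
    Matrix V V R :=
  Matrix.of fun i j => M.symEntry (π s(i, j))

/-- The Gram matrix of a family of vectors for the standard bilinear form. -/
def gramMatrix {V R : Type*} [CommRing R] {n : ℕ} (u : V → Fin n → R) : Matrix V V R :=
  Matrix.of fun i j => u i ⬝ᵥ u j

theorem gramMatrix_isSymm {V R : Type*} [CommRing R] {n : ℕ} (u : V → Fin n → R) :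
    (gramMatrix u).IsSymm := by
  ext i j
  exact dotProduct_comm (u j) (u i)

/-- The vectors `u i` lie on the unit sphere, outside the hyperplane on which the coordinate `k`
is `-1`. -/
def IsSphereFamily {V : Type*} {n : ℕ} (k : Fin n) (u : V → Fin n → ℂ) : Prop :=
  ∀ i, u i ⬝ᵥ u i = 1 ∧ u i k ≠ -1

theorem isSphereFamily_single {V : Type*} {n : ℕ} (k : Fin n) (c : V → Fin n) :
    IsSphereFamily k fun i => Pi.single (c i) (1 : ℂ) := by
  intro i
  refine ⟨by simp, ?_⟩
  simp only [Pi.single_apply]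
  split_ifs
  · norm_num
  · norm_num

/-- Unit vectors, orthogonal on `L` but for three of them, which lie in a plane. -/
theorem exists_isSphereFamily_triangle {V : Type*} [DecidableEq V] {n : ℕ} (k : Fin n)
    {L : Finset V} (hL : L.card = n + 1) {x y z : V} (hx : x ∈ L) (hy : y ∈ L) (hz : z ∈ L)
    (hxy : x ≠ y) (hxz : x ≠ z) (hyz : y ≠ z) {b c s t : ℂ} (hcs : c * c + s * s = 1)
    (hbt : b * b + t * t = 1) (hb : b ≠ -1) (hc : c ≠ -1) (hs : s ≠ -1) (ht : t ≠ -1) :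
    ∃ u : V → Fin n → ℂ, IsSphereFamily k u ∧ (gramMatrix u).symEntry s(x, y) = c ∧
      (gramMatrix u).symEntry s(x, z) = b ∧ (gramMatrix u).symEntry s(y, z) = c * b + s * t ∧
      ∀ e ∈ L.edges, e ≠ s(x, y) → e ≠ s(x, z) → e ≠ s(y, z) →
        (gramMatrix u).symEntry e = 0 := by
  have hcard : (L.erase z).card = n := by rw [Finset.card_erase_of_mem hz, hL]; rfl
  obtain ⟨g, hg⟩ : ∃ g : V → Fin n, Set.InjOn g (L.erase z) := by
    have e := (L.erase z).equivFinOfCardEq hcard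
    refine ⟨fun v => if h : v ∈ L.erase z then e ⟨v, h⟩ else k, fun v hv w hw h => ?_⟩
    rw [Finset.mem_coe] at hv hw
    simp only [hv, hw, dite_true] at h
    exact Subtype.ext_iff.1 (e.injective h)
  have hgne : ∀ v ∈ L, ∀ w ∈ L, v ≠ z → w ≠ z → v ≠ w → g v ≠ g w := by
    intro v hv w hw hvz hwz hvw h
    exact hvw (hg (by simp [hv, hvz]) (by simp [hw, hwz]) h)
  have hgxy : g x ≠ g y := hgne x hx y hy hxz hyz hxy
  -- The points of `L` other than `z` get distinct basis vectors through `g`; then `y` and `z` are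
  -- put in the plane of `g x` and `g y`.
  set u : V → Fin n → ℂ := fun i =>
    if i = z then Pi.single (g x) b + Pi.single (g y) t
    else if i = y then Pi.single (g x) c + Pi.single (g y) s
    else Pi.single (g i) 1 with hu
  have huz : u z = Pi.single (g x) b + Pi.single (g y) t := by simp [hu]
  have huy : u y = Pi.single (g x) c + Pi.single (g y) s := by simp [hu, hyz]
  have huo : ∀ i, i ≠ z → i ≠ y → u i = Pi.single (g i) 1 := by
    intro i h1 h2; simp [hu, h1, h2]
  have hsym := gramMatrix_isSymm u
  have hdot : ∀ i j, (gramMatrix u).symEntry s(i, j) = u i ⬝ᵥ u j := fun i j =>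
    Matrix.symEntry_mk hsym i j
  have hco : ∀ α β : ℂ, α ≠ -1 → β ≠ -1 → (Pi.single (g x) α + Pi.single (g y) β : Fin n → ℂ) k ≠
      -1 := by
    intro α β hα hβ
    rw [Pi.add_apply, Pi.single_apply, Pi.single_apply]
    by_cases h1 : k = g x
    · rw [if_pos h1, if_neg (fun h2 => hgxy (h1.symm.trans h2)), add_zero]; exact hα
    · rw [if_neg h1, zero_add]
      split_ifs
      · exact hβ
      · norm_num
  refine ⟨u, ?_, ?_, ?_, ?_, ?_⟩
  · intro i
    by_cases h1 : i = z
    · subst h1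
      rw [huz]
      refine ⟨?_, hco _ _ hb ht⟩
      simp [hgxy, hgxy.symm, hbt]
    by_cases h2 : i = y
    · subst h2
      rw [huy]
      refine ⟨?_, hco _ _ hc hs⟩
      simp [hgxy, hgxy.symm, hcs]
    rw [huo i h1 h2]
    exact isSphereFamily_single k g i
  · rw [hdot, huo x hxz hxy, huy]
    simp [hgxy]
  · rw [hdot, huo x hxz hxy, huz]
    simp [hgxy]
  · rw [hdot, huy, huz]
    simp [hgxy, hgxy.symm]
  · intro e
    induction e with
    | _ i j =>
      rw [Finset.mk_mem_edges, hdot]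
      rintro ⟨hi, hj, hij⟩ h1 h2 h3
      have key : ∀ i j, i ∈ L → j ∈ L → i ≠ j → s(i, j) ≠ s(x, z) → s(i, j) ≠ s(y, z) →
          j = z → u i ⬝ᵥ u j = 0 := by
        rintro i j hi hj hij h2 h3 rfl
        have hix : i ≠ x := fun h => h2 (by rw [h])
        have hiy : i ≠ y := fun h => h3 (by rw [h])
        rw [huz, huo i hij hiy]
        simp [hgne i hi x hx hij hxz hix, hgne i hi y hy hij hyz hiy]
      have key' : ∀ i j, i ∈ L → j ∈ L → i ≠ j → s(i, j) ≠ s(x, y) → i ≠ z →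
          j = y → u i ⬝ᵥ u j = 0 := by
        rintro i j hi hj hij h2 hiz rfl
        have hix : i ≠ x := fun h => h2 (by rw [h])
        rw [huy, huo i hiz hij]
        simp [hgne i hi x hx hiz hxz hix, hgne i hi j hy hiz hyz hij]
      by_cases hjz : j = z
      · exact key i j hi hj hij h2 h3 hjz
      by_cases hiz : i = z
      · rw [dotProduct_comm]
        exact key j i hj hi hij.symm (by rwa [Sym2.eq_swap]) (by rwa [Sym2.eq_swap]) hiz
      by_cases hjy : j = y
      · exact key' i j hi hj hij h1 hiz hjy
      by_cases hiy : i = y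
      · rw [dotProduct_comm]
        exact key' j i hj hi hij.symm (by rwa [Sym2.eq_swap]) hjz hiy
      rw [huo i hiz hiy, huo j hjz hjy]
      simp [hgne i hi j hj hiz hjz hij]

/-! ### Invertibility of sparse matrices -/

theorem Matrix.det_ne_zero_of_kernel {ι : Type*} [Fintype ι] [DecidableEq ι] {M : Matrix ι ι ℂ}
    (h : ∀ v : ι → ℂ, (∀ i, ∑ j, M i j * v j = 0) → ∀ i, v i = 0) : M.det ≠ 0 := by
  intro hdet
  obtain ⟨v, hv, hMv⟩ := Matrix.exists_mulVec_eq_zero_iff.2 hdet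
  exact hv (funext (h v fun i => congrFun hMv i))

/-- A matrix with ones on the diagonal is invertible if its nonzero entries off the diagonal lie at
two disjoint pairs of indices and differ from `1` and `-1`. -/
theorem Matrix.det_ne_zero_of_matching {ι : Type*} [Fintype ι] [DecidableEq ι] {M : Matrix ι ι ℂ}
    (hdiag : ∀ i, M i i = 1) {p q r t : ι} (hpq : p ≠ q) (hpr : p ≠ r) (hpt : p ≠ t) (hqr : q ≠ r)
    (hqt : q ≠ t) (hrt : r ≠ t) {a b : ℂ} (ha : 1 - a * a ≠ 0) (hb : 1 - b * b ≠ 0)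
    (h1 : M p q = a) (h2 : M q p = a) (h3 : M r t = b) (h4 : M t r = b)
    (h0 : ∀ i j, i ≠ j → s(i, j) ≠ s(p, q) → s(i, j) ≠ s(r, t) → M i j = 0) : M.det ≠ 0 := by
  refine Matrix.det_ne_zero_of_kernel fun v hv => ?_
  have hsum : ∀ (i : ι) (s : Finset ι), (∀ j ∉ s, M i j = 0) → ∑ j ∈ s, M i j * v j = 0 := by
    intro i s hs
    rw [← hv i]
    exact Finset.sum_subset (Finset.subset_univ s) fun j _ hj => by rw [hs j hj, zero_mul]
  have ep := hsum p {p, q} (fun j hj => h0 p j (by grind) (by grind) (by grind))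
  have eq := hsum q {p, q} (fun j hj => h0 q j (by grind) (by grind) (by grind))
  have er := hsum r {r, t} (fun j hj => h0 r j (by grind) (by grind) (by grind))
  have et := hsum t {r, t} (fun j hj => h0 t j (by grind) (by grind) (by grind))
  rw [Finset.sum_pair hpq, hdiag, h1] at ep
  rw [Finset.sum_pair hpq, hdiag, h2] at eq
  rw [Finset.sum_pair hrt, hdiag, h3] at er
  rw [Finset.sum_pair hrt, hdiag, h4] at et
  have vp : v p = 0 := (mul_eq_zero.1 (by linear_combination ep - a * eq :
    (1 - a * a) * v p = 0)).resolve_left ha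
  have vr : v r = 0 := (mul_eq_zero.1 (by linear_combination er - b * et :
    (1 - b * b) * v r = 0)).resolve_left hb
  have vq : v q = 0 := by linear_combination eq - a * vp
  have vt : v t = 0 := by linear_combination et - b * vr
  intro i
  by_cases hip : i = p
  · rw [hip, vp]
  by_cases hiq : i = q
  · rw [hiq, vq]
  by_cases hir : i = r
  · rw [hir, vr]
  by_cases hit : i = t
  · rw [hit, vt]
  have ei := hsum i {i} (fun j hj => h0 i j (by grind) (by grind) (by grind))
  rwa [Finset.sum_singleton, hdiag, one_mul] at ei

/-- A matrix with ones on the diagonal whose nonzero entries off the diagonal lie on a star with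
three edges. -/
theorem Matrix.det_ne_zero_of_star {ι : Type*} [Fintype ι] [DecidableEq ι] {M : Matrix ι ι ℂ}
    (hdiag : ∀ i, M i i = 1) {o p q r : ι} (hop : o ≠ p) (hoq : o ≠ q) (hor : o ≠ r) (hpq : p ≠ q)
    (hpr : p ≠ r) (hqr : q ≠ r) {a b c : ℂ} (habc : 1 - a * a - b * b - c * c ≠ 0)
    (h1 : M o p = a) (h2 : M p o = a) (h3 : M o q = b) (h4 : M q o = b) (h5 : M o r = c)
    (h6 : M r o = c)
    (h0 : ∀ i j, i ≠ j → s(i, j) ≠ s(o, p) → s(i, j) ≠ s(o, q) → s(i, j) ≠ s(o, r) →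
      M i j = 0) : M.det ≠ 0 := by
  refine Matrix.det_ne_zero_of_kernel fun v hv => ?_
  have hsum : ∀ (i : ι) (s : Finset ι), (∀ j ∉ s, M i j = 0) → ∑ j ∈ s, M i j * v j = 0 := by
    intro i s hs
    rw [← hv i]
    exact Finset.sum_subset (Finset.subset_univ s) fun j _ hj => by rw [hs j hj, zero_mul]
  have eo := hsum o {o, p, q, r}
    (fun j hj => h0 o j (by grind) (by grind) (by grind) (by grind))
  have ep := hsum p {o, p} (fun j hj => h0 p j (by grind) (by grind) (by grind) (by grind))
  have eq := hsum q {o, q} (fun j hj => h0 q j (by grind) (by grind) (by grind) (by grind))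
  have er := hsum r {o, r} (fun j hj => h0 r j (by grind) (by grind) (by grind) (by grind))
  rw [Finset.sum_insert (by simp [hop, hoq, hor]), Finset.sum_insert (by simp [hpq, hpr]),
    Finset.sum_pair hqr, hdiag, h1, h3, h5] at eo
  rw [Finset.sum_pair hop, hdiag, h2] at ep
  rw [Finset.sum_pair hoq, hdiag, h4] at eq
  rw [Finset.sum_pair hor, hdiag, h6] at er
  have vo : v o = 0 := (mul_eq_zero.1 (by linear_combination eo - a * ep - b * eq - c * er :
    (1 - a * a - b * b - c * c) * v o = 0)).resolve_left habc
  have vp : v p = 0 := by linear_combination ep - a * vo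
  have vq : v q = 0 := by linear_combination eq - b * vo
  have vr : v r = 0 := by linear_combination er - c * vo
  intro i
  by_cases hio : i = o
  · rw [hio, vo]
  by_cases hip : i = p
  · rw [hip, vp]
  by_cases hiq : i = q
  · rw [hiq, vq]
  by_cases hir : i = r
  · rw [hir, vr]
  have ei := hsum i {i} (fun j hj => h0 i j (by grind) (by grind) (by grind) (by grind))
  rwa [Finset.sum_singleton, hdiag, one_mul] at ei

/-! ### Permutations of pairs with vanishing minors -/

/-- Some family of unit vectors has a Gram matrix for which the principal minor of the rearranged
matrix on the index set `K` does not vanish. -/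
def HasNonzeroMinor {V : Type*} [DecidableEq V] {n : ℕ} (k : Fin n) (π : Sym2 V → Sym2 V)
    (K : Finset V) : Prop :=
  ∃ u : V → Fin n → ℂ, IsSphereFamily k u ∧
    (((gramMatrix u).rearrange π).submatrix (Subtype.val : K → V) Subtype.val).det ≠ 0

theorem not_isDiag_of_fix_diag {V : Type*} {π : Equiv.Perm (Sym2 V)}
    (hπ : ∀ e, e.IsDiag → π e = e) (e : Sym2 V) (he : ¬ e.IsDiag) : ¬ (π e).IsDiag := by
  intro h
  have := π.injective (hπ _ h)
  exact he (this ▸ h)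

theorem rearrange_gramMatrix_diag {V : Type*} {n : ℕ} {k : Fin n} {u : V → Fin n → ℂ}
    (hu : IsSphereFamily k u) {π : Sym2 V → Sym2 V} (hπ : ∀ e, e.IsDiag → π e = e) (i : V) :
    (gramMatrix u).rearrange π i i = 1 := by
  rw [Matrix.rearrange, Matrix.of_apply, hπ _ (by simp), Matrix.symEntry_mk (gramMatrix_isSymm u)]
  exact (hu i).1

/-- A rearrangement with vanishing `(n + 1)`-minors maps cliques on `n + 1` points to cliques. -/
theorem exists_image_edges_eq {V : Type*} [Fintype V] [DecidableEq V] {n : ℕ} {k : Fin n}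
    {π : Equiv.Perm (Sym2 V)} (hπ : ∀ e, e.IsDiag → π e = e) {K : Finset V} (hK : K.card = n + 1)
    (h : ¬ HasNonzeroMinor k π K) :
    ∃ L : Finset V, L.card = n + 1 ∧ K.edges.image π = L.edges := by
  have hcard : (K.edges.image π).card = (n + 1).choose 2 := by
    rw [Finset.card_image_of_injective _ π.injective, Finset.card_edges, hK]
  have hnd : ∀ e ∈ K.edges.image π, ¬ e.IsDiag := by
    intro e he
    obtain ⟨f, hf, rfl⟩ := Finset.mem_image.1 he
    exact not_isDiag_of_fix_diag hπ f (Finset.mem_filter.1 hf).2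
  refine (exists_coloring_or_eq_edges k.pos _ hnd hcard).resolve_left ?_
  rintro ⟨c, hc⟩
  refine h ⟨fun i => Pi.single (c i) 1, isSphereFamily_single k c, ?_⟩
  have hone : ((gramMatrix fun i => Pi.single (c i) (1 : ℂ)).rearrange π).submatrix
      (Subtype.val : K → V) (Subtype.val : K → V) = 1 := by
    ext i j
    rw [Matrix.submatrix_apply]
    by_cases hij : i = j
    · subst hij
      rw [rearrange_gramMatrix_diag (isSphereFamily_single k c) hπ, Matrix.one_apply_eq]
    · rw [Matrix.one_apply_ne hij]
      have hmem : π s(i.1, j.1) ∈ K.edges.image π :=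
        Finset.mem_image_of_mem _
          (Finset.mk_mem_edges.2 ⟨i.2, j.2, fun h => hij (Subtype.ext h)⟩)
      rw [Matrix.rearrange, Matrix.of_apply]
      generalize π s(i.1, j.1) = e at hmem
      induction e with
      | _ a b =>
        rw [Matrix.symEntry_mk (gramMatrix_isSymm _)]
        simp [gramMatrix, hc a b hmem]
  rw [hone, Matrix.det_one]
  exact one_ne_zero

section

variable {V : Type*} [Fintype V] [DecidableEq V] {n : ℕ} {k : Fin n} {π : Equiv.Perm (Sym2 V)}

/-- If the preimages were disjoint, some `(n + 1)`-set `K` would contain their four endpoints, as `n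
≥ 3`. A test family whose only nonzero products on the image clique are at `xz` and `yz` then gives
an invertible matrix supported on the diagonal and a matching. -/
theorem exists_mem_symm_of_adjacent (hn : 3 ≤ n) (hV : n < Fintype.card V)
    (hπ : ∀ e, e.IsDiag → π e = e)
    (h : ∀ K : Finset V, K.card = n + 1 → ¬ HasNonzeroMinor k π K) {x y z : V} (hxy : x ≠ y)
    (hxz : x ≠ z) (hyz : y ≠ z) : ∃ p, p ∈ π.symm s(x, z) ∧ p ∈ π.symm s(y, z) := by
  by_contra! hdisj
  have hnd := not_isDiag_of_fix_diag hπ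
  obtain ⟨e, he⟩ : ∃ e, π.symm s(x, z) = e := ⟨_, rfl⟩
  obtain ⟨f, hf⟩ : ∃ f, π.symm s(y, z) = f := ⟨_, rfl⟩
  rw [he, hf] at hdisj
  rw [Equiv.symm_apply_eq] at he hf
  induction e with
  | _ p q =>
  induction f with
  | _ r t =>
  have hpq : p ≠ q := by
    rintro rfl
    rw [hπ _ (by simp), Sym2.eq_iff] at he
    grind
  have hrt : r ≠ t := by
    rintro rfl
    rw [hπ _ (by simp), Sym2.eq_iff] at hf
    grind
  simp only [Sym2.mem_iff] at hdisj
  have hpr : p ≠ r := by grind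
  have hpt : p ≠ t := by grind
  have hqr : q ≠ r := by grind
  have hqt : q ≠ t := by grind
  obtain ⟨K, hsub, hK⟩ := Finset.exists_superset_card_eq (s := {p, q, r, t}) (n := n + 1)
    (Finset.card_le_four.trans (by omega)) hV
  have hpK : p ∈ K := hsub (by simp)
  have hqK : q ∈ K := hsub (by simp)
  have hrK : r ∈ K := hsub (by simp)
  have htK : t ∈ K := hsub (by simp)
  obtain ⟨L, hL, himg⟩ := exists_image_edges_eq hπ hK (h K hK)
  have hmem : ∀ i ∈ K, ∀ j ∈ K, i ≠ j → π s(i, j) ∈ L.edges := fun i hi j hj hij => by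
    rw [← himg]
    exact Finset.mem_image_of_mem _ (Finset.mk_mem_edges.2 ⟨hi, hj, hij⟩)
  have hm1 := hmem p hpK q hqK hpq
  have hm2 := hmem r hrK t htK hrt
  rw [← he, Finset.mk_mem_edges] at hm1
  rw [← hf, Finset.mk_mem_edges] at hm2
  -- The products at `xy`, `xz`, `yz` are `0`, `3 / 5`, `4 / 5`; the rational values come from the
  -- triple 3, 4, 5.
  obtain ⟨u, hu, u1, u2, u3, u0⟩ := exists_isSphereFamily_triangle (b := 3 / 5) (c := 0) (s := 1)
    (t := 4 / 5) k hL hm1.1 hm2.1 hm1.2.1 hxy hxz hyz (by norm_num) (by norm_num) (by norm_num)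
    (by norm_num) (by norm_num) (by norm_num)
  refine h K hK ⟨u, hu, Matrix.det_ne_zero_of_matching (p := ⟨p, hpK⟩) (q := ⟨q, hqK⟩)
    (r := ⟨r, hrK⟩) (t := ⟨t, htK⟩) (a := 3 / 5) (b := 4 / 5)
    (fun i => rearrange_gramMatrix_diag hu hπ i.1) (by simpa) (by simpa) (by simpa) (by simpa)
    (by simpa) (by simpa) (by norm_num) (by norm_num) ?_ ?_ ?_ ?_ ?_⟩
  · simp only [Matrix.submatrix_apply, Matrix.rearrange, Matrix.of_apply]
    rw [← he, u2]
  · simp only [Matrix.submatrix_apply, Matrix.rearrange, Matrix.of_apply]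
    rw [Sym2.eq_swap, ← he, u2]
  · simp only [Matrix.submatrix_apply, Matrix.rearrange, Matrix.of_apply]
    rw [← hf, u3]
    norm_num
  · simp only [Matrix.submatrix_apply, Matrix.rearrange, Matrix.of_apply]
    rw [Sym2.eq_swap, ← hf, u3]
    norm_num
  · intro i j hij h1 h2
    simp only [Matrix.submatrix_apply, Matrix.rearrange, Matrix.of_apply]
    by_cases h3 : π s(i.1, j.1) = s(x, y)
    · rw [h3, u1]
    refine u0 _ (hmem _ i.2 _ j.2 fun h => hij (Subtype.ext h)) h3 ?_ ?_
    · rw [he]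
      intro h4
      have h5 := π.injective h4
      simp only [Sym2.eq_iff, ne_eq, Subtype.ext_iff] at h1 h5
      exact h1 h5
    · rw [hf]
      intro h4
      have h5 := π.injective h4
      simp only [Sym2.eq_iff, ne_eq, Subtype.ext_iff] at h2 h5
      exact h2 h5

/-- This excludes the other configuration of three pairwise intersecting edges: planar unit vectors
at `x`, `y`, `z`, moved to a star, have an invertible matrix. -/
theorem symm_triangle_ne_star (hn : 3 ≤ n) (hV : n < Fintype.card V)
    (hπ : ∀ e, e.IsDiag → π e = e)
    (h : ∀ K : Finset V, K.card = n + 1 → ¬ HasNonzeroMinor k π K) {x y z : V} (hxy : x ≠ y)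
    (hxz : x ≠ z) (hyz : y ≠ z) {o p q r : V} (hp : s(x, y) = π s(o, p)) (hq : s(x, z) = π s(o, q))
    (hr : s(y, z) = π s(o, r)) : False := by
  have hne : ∀ {a b v w : V}, a ≠ b → s(a, b) = π s(v, w) → v ≠ w := by
    rintro a b v w hab h1 rfl
    rw [hπ _ (by simp), Sym2.eq_iff] at h1
    grind
  have hop := hne hxy hp
  have hoq := hne hxz hq
  have hor := hne hyz hr
  have hpq : p ≠ q := by
    rintro rfl
    rw [← hp, Sym2.eq_iff] at hq
    grind
  have hpr : p ≠ r := by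
    rintro rfl
    rw [← hp, Sym2.eq_iff] at hr
    grind
  have hqr : q ≠ r := by
    rintro rfl
    rw [← hq, Sym2.eq_iff] at hr
    grind
  obtain ⟨K, hsub, hK⟩ := Finset.exists_superset_card_eq (s := {o, p, q, r}) (n := n + 1)
    (Finset.card_le_four.trans (by omega)) hV
  have hoK : o ∈ K := hsub (by simp)
  have hpK : p ∈ K := hsub (by simp)
  have hqK : q ∈ K := hsub (by simp)
  have hrK : r ∈ K := hsub (by simp)
  obtain ⟨L, hL, himg⟩ := exists_image_edges_eq hπ hK (h K hK)
  have hmem : ∀ i ∈ K, ∀ j ∈ K, i ≠ j → π s(i, j) ∈ L.edges := fun i hi j hj hij => by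
    rw [← himg]
    exact Finset.mem_image_of_mem _ (Finset.mk_mem_edges.2 ⟨hi, hj, hij⟩)
  have hm1 := hmem o hoK p hpK hop
  have hm2 := hmem o hoK q hqK hoq
  rw [← hp, Finset.mk_mem_edges] at hm1
  rw [← hq, Finset.mk_mem_edges] at hm2
  -- The third product is `c * b + s * t = 24 / 25`, and `1 - a² - b² - c²` for the star weights `3
  -- / 5`, `4 / 5`, `24 / 25` is `-(24 / 25)²`.
  obtain ⟨u, hu, u1, u2, u3, u0⟩ := exists_isSphereFamily_triangle (b := 4 / 5) (c := 3 / 5)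
    (s := 4 / 5) (t := 3 / 5) k hL hm1.1 hm1.2.1 hm2.2.1 hxy hxz hyz (by norm_num) (by norm_num)
    (by norm_num) (by norm_num) (by norm_num) (by norm_num)
  refine h K hK ⟨u, hu, Matrix.det_ne_zero_of_star (o := ⟨o, hoK⟩) (p := ⟨p, hpK⟩)
    (q := ⟨q, hqK⟩) (r := ⟨r, hrK⟩) (a := 3 / 5) (b := 4 / 5) (c := 24 / 25)
    (fun i => rearrange_gramMatrix_diag hu hπ i.1) (by simpa) (by simpa) (by simpa) (by simpa)
    (by simpa) (by simpa) (by norm_num) ?_ ?_ ?_ ?_ ?_ ?_ ?_⟩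
  · simp only [Matrix.submatrix_apply, Matrix.rearrange, Matrix.of_apply]
    rw [← hp, u1]
  · simp only [Matrix.submatrix_apply, Matrix.rearrange, Matrix.of_apply]
    rw [Sym2.eq_swap, ← hp, u1]
  · simp only [Matrix.submatrix_apply, Matrix.rearrange, Matrix.of_apply]
    rw [← hq, u2]
  · simp only [Matrix.submatrix_apply, Matrix.rearrange, Matrix.of_apply]
    rw [Sym2.eq_swap, ← hq, u2]
  · simp only [Matrix.submatrix_apply, Matrix.rearrange, Matrix.of_apply]
    rw [← hr, u3]
    norm_num
  · simp only [Matrix.submatrix_apply, Matrix.rearrange, Matrix.of_apply]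
    rw [Sym2.eq_swap, ← hr, u3]
    norm_num
  · intro i j hij h1 h2 h3
    simp only [Matrix.submatrix_apply, Matrix.rearrange, Matrix.of_apply]
    have hinj : ∀ {v w : K}, s(i, j) ≠ s(v, w) → π s(i.1, j.1) ≠ π s(v.1, w.1) := by
      intro v w h4 h5
      have h6 := π.injective h5
      simp only [Sym2.eq_iff, ne_eq, Subtype.ext_iff] at h4 h6
      exact h4 h6
    refine u0 _ (hmem _ i.2 _ j.2 fun h => hij (Subtype.ext h)) ?_ ?_ ?_
    · rw [hp]; exact hinj h1
    · rw [hq]; exact hinj h2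
    · rw [hr]; exact hinj h3

/-- A permutation of the unordered pairs for which all principal `(n + 1)`-minors of the rearranged
Gram matrices vanish is induced by a permutation of the points. -/
theorem exists_perm_of_minors (hn : 2 ≤ n) (hV : n < Fintype.card V)
    (hπ : ∀ e, e.IsDiag → π e = e)
    (h : ∀ K : Finset V, K.card = n + 1 → ¬ HasNonzeroMinor k π K) :
    ∃ σ : Equiv.Perm V, ∀ x y, x ≠ y → π s(x, y) = s(σ x, σ y) := by
  have hnd := not_isDiag_of_fix_diag hπ
  have hV3 : 3 ≤ Nat.card V := by rw [Nat.card_eq_fintype_card]; omega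
  rcases hn.eq_or_lt with rfl | hn
  -- For `n = 2` the set `L` has three points: too few for two disjoint edges or for a star with
  -- three edges.
  · refine exists_perm_of_triangles hV3 π hnd fun x y z hxy hxz hyz => ?_
    have hK : ({x, y, z} : Finset V).card = 2 + 1 :=
      Finset.card_eq_three.2 ⟨x, y, z, hxy, hxz, hyz, rfl⟩
    obtain ⟨L, hL, himg⟩ := exists_image_edges_eq hπ hK (h _ hK)
    have hmem : ∀ i ∈ ({x, y, z} : Finset V), ∀ j ∈ ({x, y, z} : Finset V), i ≠ j →
        π s(i, j) ∈ L.edges := fun i hi j hj hij => by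
      rw [← himg]
      exact Finset.mem_image_of_mem _ (Finset.mk_mem_edges.2 ⟨hi, hj, hij⟩)
    have hfour : ∀ a ∈ L, ∀ b ∈ L, ∀ c ∈ L, ∀ d ∈ L, a ≠ b → a ≠ c → a ≠ d → b ≠ c → b ≠ d →
        c ≠ d → False := by
      intro a ha b hb c hc d hd h1 h2 h3 h4 h5 h6
      have hsub : ({a, b, c, d} : Finset V) ⊆ L := by
        intro v hv
        simp only [Finset.mem_insert, Finset.mem_singleton] at hv
        rcases hv with rfl | rfl | rfl | rfl <;> assumption
      have hc4 : ({a, b, c, d} : Finset V).card = 4 := by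
        rw [Finset.card_insert_of_notMem (by simp [h1, h2, h3]),
          Finset.card_insert_of_notMem (by simp [h4, h5]), Finset.card_pair h6]
      have := Finset.card_le_card hsub
      omega
    have hint : ∀ e ∈ L.edges, ∀ f ∈ L.edges, ∃ p, p ∈ e ∧ p ∈ f := by
      intro e he f hf
      induction e with
      | _ a b =>
      induction f with
      | _ c d =>
      rw [Finset.mk_mem_edges] at he hf
      by_contra! hd
      simp only [Sym2.mem_iff] at hd
      exact hfour a he.1 b he.2.1 c hf.1 d hf.2.1 he.2.2 (by grind) (by grind) (by grind)
        (by grind) hf.2.2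
    have m1 := hmem x (by simp) y (by simp) hxy
    have m2 := hmem x (by simp) z (by simp) hxz
    have m3 := hmem y (by simp) z (by simp) hyz
    have n1 : π s(x, y) ≠ π s(x, z) := π.injective.ne (by simp only [ne_eq, Sym2.eq_iff]; grind)
    have n2 : π s(x, y) ≠ π s(y, z) := π.injective.ne (by simp only [ne_eq, Sym2.eq_iff]; grind)
    have n3 : π s(x, z) ≠ π s(y, z) := π.injective.ne (by simp only [ne_eq, Sym2.eq_iff]; grind)
    refine (Sym2.triangle_or_star (hnd _ (by simpa)) (hnd _ (by simpa)) (hnd _ (by simpa)) n1 n2 n3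
      (hint _ m1 _ m2) (hint _ m1 _ m3) (hint _ m2 _ m3)).resolve_right ?_
    rintro ⟨p, a, b, c, h1, h2, h3⟩
    rw [h1] at m1 n1 n2
    rw [h2] at m2 n1 n3
    rw [h3] at m3 n2 n3
    rw [Finset.mk_mem_edges] at m1 m2 m3
    exact hfour p m1.1 a m1.2.1 b m2.2.1 c m3.2.1 m1.2.2 m2.2.2 m3.2.2 (by grind) (by grind)
      (by grind)
  -- The inverse is used because the planar triple of a test family lives on the target side of `π`.
  · have hfix : ∀ e : Sym2 V, e.IsDiag → π.symm e = e := fun e he => by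
      rw [Equiv.symm_apply_eq, hπ e he]
    have hnd' := not_isDiag_of_fix_diag (π := π.symm) hfix
    obtain ⟨σ, hσ⟩ := exists_perm_of_triangles hV3 π.symm hnd' fun x y z hxy hxz hyz => by
      have n1 : π.symm s(x, y) ≠ π.symm s(x, z) :=
        π.symm.injective.ne (by simp only [ne_eq, Sym2.eq_iff]; grind)
      have n2 : π.symm s(x, y) ≠ π.symm s(y, z) :=
        π.symm.injective.ne (by simp only [ne_eq, Sym2.eq_iff]; grind)
      have n3 : π.symm s(x, z) ≠ π.symm s(y, z) :=
        π.symm.injective.ne (by simp only [ne_eq, Sym2.eq_iff]; grind)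
      have i1 := exists_mem_symm_of_adjacent hn hV hπ h hyz hxy.symm hxz.symm
      have i2 := exists_mem_symm_of_adjacent hn hV hπ h hxz hxy hyz.symm
      have i3 := exists_mem_symm_of_adjacent hn hV hπ h hxy hxz hyz
      rw [Sym2.eq_swap, Sym2.eq_swap (a := z)] at i1
      rw [Sym2.eq_swap (a := z)] at i2
      refine (Sym2.triangle_or_star (hnd' _ (by simpa)) (hnd' _ (by simpa)) (hnd' _ (by simpa))
        n1 n2 n3 i1 i2 i3).resolve_right ?_
      rintro ⟨p, a, b, c, h1, h2, h3⟩
      rw [Equiv.symm_apply_eq] at h1 h2 h3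
      exact symm_triangle_ne_star hn hV hπ h hxy hxz hyz h1 h2 h3
    refine ⟨σ.symm, fun x y hxy => ?_⟩
    rw [← Equiv.eq_symm_apply, hσ _ _ (σ.symm.injective.ne hxy), Equiv.apply_symm_apply,
      Equiv.apply_symm_apply]

end

/-! ### Parametrization and generic conditions -/

/-- A polynomial parametrization of the families of vectors of equal norm: the vector with index `i`
is the image of the basis vector with index `k` under the reflection that fixes `y i`, scaled by the
product of the squared norms of all `y j`. -/
def sphereParam {V R : Type*} [Fintype V] [DecidableEq V] [CommRing R] {n : ℕ} (k : Fin n)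
    (y : V → Fin n → R) (i : V) : Fin n → R :=
  (∏ j ∈ Finset.univ.erase i, y j ⬝ᵥ y j) •
    ((2 * y i k) • y i - (y i ⬝ᵥ y i) • Pi.single k 1)

section

variable {V : Type*} [Fintype V] [DecidableEq V] {n : ℕ}

/-- The reflected vector, cleared of denominators, has squared norm `(y i ⬝ᵥ y i) ^ 2`; the
remaining factors make the result independent of `i`. -/
theorem sphereParam_dotProduct_self {R : Type*} [CommRing R] (k : Fin n) (y : V → Fin n → R)
    (i : V) : sphereParam k y i ⬝ᵥ sphereParam k y i = (∏ j, y j ⬝ᵥ y j) ^ 2 := by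
  rw [← Finset.mul_prod_erase Finset.univ (fun j => y j ⬝ᵥ y j) (Finset.mem_univ i), sphereParam]
  simp only [smul_dotProduct, dotProduct_smul, sub_dotProduct, dotProduct_sub, smul_eq_mul,
    single_dotProduct, dotProduct_single, Pi.sub_apply, Pi.smul_apply, Pi.single_eq_same]
  ring

theorem gramMatrix_sphereParam_map {R S : Type*} [CommRing R] [CommRing S] (φ : R →+* S)
    (k : Fin n) (y : V → Fin n → R) (i j : V) :
    φ (gramMatrix (sphereParam k y) i j) =
      gramMatrix (sphereParam k fun i l => φ (y i l)) i j := by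
  simp [gramMatrix, sphereParam, dotProduct, Pi.single_apply, apply_ite φ, map_ofNat φ 2]

/-- The reflection fixing the bisector of the basis vector and `u i` exchanges them. The bisector
can be normalized because its squared norm `2 + 2 * u i k` is nonzero. -/
theorem exists_sphereParam_eq {k : Fin n} {u : V → Fin n → ℂ} (hu : IsSphereFamily k u) :
    ∃ y : V → Fin n → ℂ, sphereParam k y = u := by
  have hex : ∀ i, ∃ w : Fin n → ℂ, w ⬝ᵥ w = 1 ∧ (2 * w k) • w - Pi.single k 1 = u i := by
    intro i
    obtain ⟨h1, h2⟩ := hu i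
    have h3 : 2 + 2 * u i k ≠ 0 := fun h => h2 (by linear_combination h / 2)
    obtain ⟨d, hd⟩ := IsAlgClosed.exists_eq_mul_self (2 + 2 * u i k)
    have hd0 : d ≠ 0 := by rintro rfl; exact h3 (by simpa using hd)
    refine ⟨d⁻¹ • (Pi.single k 1 + u i), ?_, ?_⟩
    · simp only [smul_dotProduct, dotProduct_smul, add_dotProduct, dotProduct_add, smul_eq_mul,
        single_dotProduct, dotProduct_single, Pi.smul_apply, Pi.add_apply, Pi.single_eq_same, h1]
      field_simp
      linear_combination hd
    · ext l
      simp only [Pi.sub_apply, Pi.smul_apply, Pi.add_apply, smul_eq_mul, Pi.single_eq_same]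
      field_simp
      linear_combination ((Pi.single k 1 : Fin n → ℂ) l + u i l) * hd
  choose y hy1 hy2 using hex
  refine ⟨y, funext fun i => ?_⟩
  simp [sphereParam, hy1, hy2]

open MvPolynomial

/-- Polynomial conditions on the entries of a matrix which can be satisfied one by one by Gram
matrices of unit vectors can be satisfied together by a Gram matrix of vectors of equal norm. -/
theorem exists_gramMatrix_eval_ne_zero {ι : Type*} [Fintype ι] (k : Fin n)
    (Q : ι → MvPolynomial (V × V) ℂ)
    (hQ : ∀ i, ∃ u : V → Fin n → ℂ, IsSphereFamily k u ∧
      eval (fun p => gramMatrix u p.1 p.2) (Q i) ≠ 0) :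
    ∃ u : V → Fin n → ℂ, (∀ i j, u i ⬝ᵥ u i = u j ⬝ᵥ u j) ∧
      ∀ i, eval (fun p => gramMatrix u p.1 p.2) (Q i) ≠ 0 := by
  set g : V × V → MvPolynomial (V × Fin n) ℂ := fun p =>
    gramMatrix (sphereParam k fun i l => X (i, l)) p.1 p.2 with hg
  have heval : ∀ (y : V × Fin n → ℂ) (P : MvPolynomial (V × V) ℂ), eval y (bind₁ g P) =
      eval (fun p => gramMatrix (sphereParam k fun i l => y (i, l)) p.1 p.2) P := by
    intro y P
    rw [← coe_aeval_eq_eval, ← coe_aeval_eq_eval, RingHom.coe_coe, RingHom.coe_coe, aeval_bind₁]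
    congr 2
    funext p
    have h := gramMatrix_sphereParam_map (aeval y : MvPolynomial (V × Fin n) ℂ →ₐ[ℂ] ℂ).toRingHom k
      (fun i l => X (i, l)) p.1 p.2
    simpa [hg] using h
  have hne : ∏ i, bind₁ g (Q i) ≠ 0 := by
    refine Finset.prod_ne_zero_iff.2 fun i _ h0 => ?_
    obtain ⟨u, hu, hne⟩ := hQ i
    obtain ⟨y, rfl⟩ := exists_sphereParam_eq hu
    have := heval (fun p => y p.1 p.2) (Q i)
    rw [h0, map_zero] at this
    exact hne this.symm
  obtain ⟨y, hy⟩ : ∃ y, eval y (∏ i, bind₁ g (Q i)) ≠ 0 := by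
    by_contra! h
    exact hne (MvPolynomial.funext fun y => by rw [h y, map_zero])
  rw [map_prod, Finset.prod_ne_zero_iff] at hy
  refine ⟨sphereParam k fun i l => y (i, l), fun i j => ?_, fun i => ?_⟩
  · rw [sphereParam_dotProduct_self, sphereParam_dotProduct_self]
  · rw [← heval]
    exact hy i (Finset.mem_univ i)

/-- The polynomial is a difference of two coordinates. A point `v` of `f` outside `e` gets one basis
vector and all other points another, so the entries are `1` at `e` and `0` at `f`. -/
theorem exists_separating_polynomial (hn : 2 ≤ n) (k : Fin n) (e f : Sym2 V) :
    ∃ Q : MvPolynomial (V × V) ℂ,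
      (∃ u : V → Fin n → ℂ, IsSphereFamily k u ∧ eval (fun p => gramMatrix u p.1 p.2) Q ≠ 0) ∧
      ∀ A : Matrix V V ℂ, eval (fun p => A p.1 p.2) Q ≠ 0 → ¬ e.IsDiag → ¬ f.IsDiag → e ≠ f →
        A.symEntry e ≠ A.symEntry f := by
  by_cases hef : e = f ∨ e.IsDiag ∨ f.IsDiag
  -- The constant `1` serves the vacuous cases, so that a polynomial exists for every pair `e`, `f`.
  · refine ⟨1, ⟨_, isSphereFamily_single k fun _ => k, by simp⟩, fun A _ h1 h2 h3 => ?_⟩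
    tauto
  · push Not at hef
    obtain ⟨hne, he, hf⟩ := hef
    refine ⟨X e.out - X f.out, ?_, fun A hA _ _ _ h => hA ?_⟩
    · obtain ⟨l, hl⟩ : ∃ l : Fin n, l ≠ k := by
        have : Nontrivial (Fin n) := Fin.nontrivial_iff_two_le.2 hn
        exact exists_ne k
      induction e with
      | _ a b =>
      induction f with
      | _ c d =>
      obtain ⟨v, hv, hvab⟩ : ∃ v, v ∈ s(c, d) ∧ v ≠ a ∧ v ≠ b := by
        by_contra! h
        simp only [Sym2.mem_iff, Sym2.mk_isDiag_iff] at h he hf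
        apply hne
        rw [Sym2.eq_iff]
        have := h c
        have := h d
        grind
      obtain ⟨w, hw⟩ := hv
      have hvw : w ≠ v := by
        rintro rfl
        rw [hw] at hf
        simp at hf
      refine ⟨fun i => Pi.single (if i = v then l else k) 1, isSphereFamily_single k _, ?_⟩
      rw [hw]
      have h1 := Matrix.symEntry_mk (gramMatrix_isSymm
        fun i => (Pi.single (if i = v then l else k) 1 : Fin n → ℂ)) a b
      have h2 := Matrix.symEntry_mk (gramMatrix_isSymm
        fun i => (Pi.single (if i = v then l else k) 1 : Fin n → ℂ)) v w
      rw [Matrix.symEntry] at h1 h2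
      rw [map_sub, eval_X, eval_X, h1, h2]
      simp [gramMatrix, hvab.1.symm, hvab.2.symm, hvw, hl]
    · rw [map_sub, eval_X, eval_X, sub_eq_zero]
      exact h

theorem exists_rank_polynomial (hn : 2 ≤ n) (hV : n < Fintype.card V) (k : Fin n)
    (π : Equiv.Perm (Sym2 V)) :
    ∃ Q : MvPolynomial (V × V) ℂ,
      (∃ u : V → Fin n → ℂ, IsSphereFamily k u ∧ eval (fun p => gramMatrix u p.1 p.2) Q ≠ 0) ∧
      ∀ A : Matrix V V ℂ, eval (fun p => A p.1 p.2) Q ≠ 0 → (∀ e, e.IsDiag → π e = e) →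
        (¬ ∃ σ : Equiv.Perm V, ∀ x y, x ≠ y → π s(x, y) = s(σ x, σ y)) →
          n < (A.rearrange π).rank := by
  by_cases h : (∀ e, e.IsDiag → π e = e) ∧
      ¬ ∃ σ : Equiv.Perm V, ∀ x y, x ≠ y → π s(x, y) = s(σ x, σ y)
  · obtain ⟨hπ, hσ⟩ := h
    obtain ⟨K, hK, u, hu, hdet⟩ : ∃ K : Finset V, K.card = n + 1 ∧ HasNonzeroMinor k π K := by
      by_contra! hall
      exact hσ (exists_perm_of_minors hn hV hπ hall)
    have heval : ∀ A : Matrix V V ℂ, eval (fun p => A p.1 p.2)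
        (((Matrix.of fun i j => (X (i, j) : MvPolynomial (V × V) ℂ)).rearrange π).submatrix
          (Subtype.val : K → V) (Subtype.val : K → V)).det =
        ((A.rearrange π).submatrix (Subtype.val : K → V) (Subtype.val : K → V)).det := by
      intro A
      rw [RingHom.map_det]
      congr 1
      ext i j
      simp [Matrix.rearrange, Matrix.symEntry]
    refine ⟨_, ⟨u, hu, (heval _).trans_ne hdet⟩, fun A hA _ _ => ?_⟩
    rw [heval] at hA
    have hrank := Matrix.rank_of_det_ne_zero hA
    rw [Fintype.card_coe, hK] at hrank
    have := Matrix.rank_submatrix_le (A.rearrange π) (Subtype.val : K → V) (Subtype.val : K → V)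
    omega
  · exact ⟨1, ⟨_, isSphereFamily_single k fun _ => k, by simp⟩,
      fun A _ h1 h2 => absurd ⟨h1, h2⟩ h⟩

end

/-! ### From rearrangements to permutations, and the theorem -/

/-- A symmetric rearrangement of a matrix with constant diagonal and distinct entries above the
diagonal is given by a permutation of the unordered pairs of indices. -/
theorem IsSymmRearrangement.exists_perm {m : ℕ} {A B : Matrix (Fin m) (Fin m) ℂ}
    (h : IsSymmRearrangement A B)
    (hA : ∀ e f, ¬ e.IsDiag → ¬ f.IsDiag → e ≠ f → A.symEntry e ≠ A.symEntry f) :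
    ∃ π : Equiv.Perm (Sym2 (Fin m)), (∀ e, e.IsDiag → π e = e) ∧ B = A.rearrange π := by
  classical
  obtain ⟨hAs, hBs, hdiag, htri⟩ := h
  have hex : ∀ {M N : Matrix (Fin m) (Fin m) ℂ}, M.IsSymm → N.IsSymm →
      tripleSet M ⊆ tripleSet N → ∀ e : Sym2 (Fin m), ∃ f : Sym2 (Fin m), ¬ e.IsDiag →
        ¬ f.IsDiag ∧ N.symEntry f = M.symEntry e := by
    intro M N hM hN hMN e
    by_cases he : e.IsDiag
    · exact ⟨e, fun h => absurd he h⟩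
    induction e with
    | _ i j =>
      obtain ⟨a, b, hab, ht⟩ := hMN ⟨i, j, by simpa using he, rfl⟩
      refine ⟨s(a, b), fun _ => ⟨by simpa using hab, ?_⟩⟩
      rw [Matrix.symEntry_mk hM, Matrix.symEntry_mk hN]
      exact (congrArg (fun t => t.2.2) ht).symm
  choose p hp using hex hBs hAs htri.subset
  choose q hq using hex hAs hBs htri.symm.subset
  set τ : Sym2 (Fin m) → Sym2 (Fin m) := fun e => if e.IsDiag then e else p e with hτ
  -- Each entry of `A` occurs in `B`, and distinctness of the entries of `A` identifies its
  -- position; finiteness then makes `τ` bijective.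
  have hsurj : Function.Surjective τ := by
    intro e
    by_cases he : e.IsDiag
    · exact ⟨e, by simp [hτ, he]⟩
    · obtain ⟨hq1, hq2⟩ := hq e he
      obtain ⟨hp1, hp2⟩ := hp (q e) hq1
      refine ⟨q e, ?_⟩
      simp only [hτ, hq1, if_false]
      by_contra hne
      exact hA _ _ hp1 he hne (hp2.trans hq2)
  refine ⟨Equiv.ofBijective τ (Finite.surjective_iff_bijective.1 hsurj), fun e he => ?_, ?_⟩
  · simp [hτ, he]
  · ext i j
    rw [Matrix.rearrange, Matrix.of_apply, Equiv.ofBijective_apply, hτ]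
    by_cases hij : i = j
    · subst hij
      simp [Matrix.symEntry_mk hAs, hdiag]
    · have hd : ¬ s(i, j).IsDiag := by simpa using hij
      simp only [hd, if_false]
      rw [(hp _ hd).2, Matrix.symEntry_mk hBs]

theorem mainTheorem4 (m n : ℕ) (hn : 2 ≤ n) (hmn : n < m) :
    ∃ U : Set (Matrix (Fin m) (Fin m) ℂ),
      IsZariskiOpenIn U (SymConstDiag m n) ∧ U.Nonempty ∧
        ∀ A ∈ U, ∀ B : Matrix (Fin m) (Fin m) ℂ,
          IsSymmRearrangement A B → ¬ MatrixEquivalent A B → n < B.rank := by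
  classical
  have hV : n < Fintype.card (Fin m) := by simpa using hmn
  set k : Fin n := ⟨0, by omega⟩
  choose P hP1 hP2 using exists_separating_polynomial (V := Fin m) hn k
  choose R hR1 hR2 using exists_rank_polynomial (V := Fin m) hn hV k
  set Q : (Sym2 (Fin m) × Sym2 (Fin m)) ⊕ Equiv.Perm (Sym2 (Fin m)) →
    MvPolynomial (Fin m × Fin m) ℂ := Sum.elim (fun e => P e.1 e.2) R with hQ
  have hmem : ∀ A : Matrix (Fin m) (Fin m) ℂ,
      (fun p : Fin m × Fin m => A p.1 p.2) ∉
        MvPolynomial.zeroLocus ℂ (Ideal.span {∏ i, Q i}) ↔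
      ∀ i, MvPolynomial.eval (fun p => A p.1 p.2) (Q i) ≠ 0 := by
    intro A
    have h : (fun p : Fin m × Fin m => A p.1 p.2) ∈
        MvPolynomial.zeroLocus ℂ (Ideal.span {∏ i, Q i}) ↔
        MvPolynomial.eval (fun p => A p.1 p.2) (∏ i, Q i) = 0 := by
      rw [MvPolynomial.mem_zeroLocus_iff]
      simp only [Ideal.mem_span_singleton, MvPolynomial.aeval_eq_eval]
      constructor
      · exact fun h => h _ dvd_rfl
      · rintro h _ ⟨c, rfl⟩
        rw [map_mul, h, zero_mul]
    rw [h, map_prod, ← ne_eq, Finset.prod_ne_zero_iff]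
    simp
  refine ⟨_, ⟨Ideal.span {∏ i, Q i}, rfl⟩, ?_, ?_⟩
  · obtain ⟨u, hu1, hu2⟩ := exists_gramMatrix_eval_ne_zero k Q (by
      rintro (e | π)
      · exact hP1 e.1 e.2
      · exact hR1 π)
    refine ⟨gramMatrix u, ⟨gramMatrix_isSymm u, ?_, hu1⟩, (hmem _).2 hu2⟩
    have hmul : gramMatrix u = Matrix.of u * (Matrix.of u).transpose := rfl
    rw [hmul]
    exact (Matrix.rank_mul_le_left _ _).trans (Matrix.rank_le_width _)
  · rintro A ⟨⟨hAs, -, hdiag⟩, hA⟩ B hB hAB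
    rw [hmem] at hA
    obtain ⟨π, hπ, rfl⟩ := hB.exists_perm fun e f =>
      hP2 e f A (hA (Sum.inl (e, f)))
    refine hR2 π A (hA (Sum.inr π)) hπ ?_
    -- An induced `π` would make `B` equivalent to `A`: `σ` matches the entries off the diagonal,
    -- and the constant diagonal matches the rest.
    rintro ⟨σ, hσ⟩
    refine hAB ⟨σ, ?_⟩
    ext i j
    by_cases hij : i = j
    · subst hij
      rw [hB.2.2.1, Matrix.submatrix_apply]
      exact hdiag _ _
    · rw [Matrix.rearrange, Matrix.of_apply, hσ i j hij, Matrix.symEntry_mk hAs,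
        Matrix.submatrix_apply]
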